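/- Theorem 1 (Weak Compactness of the Wasserstein Ball). Let $(X,d)$ be a complete separable metric space that is proper, i.e. all closed balls $\{x\in X : d(x,x_0)\le R\}$ ($x_0\in X$, $R>0$) are compact, and let $\mathcal P(X)$ be the set of Borel probability measures on $X$. Let $p\in[1,\infty)$ and, for $\mu_1,\mu_2\in\mathcal P(X)$, let $$W_p(\mu_1,\mu_2)=\inf_{\gamma\in\Gamma(\mu_1,\mu_2)}\Big(\int_{X\times X} d(x_1,x_2)^p\,\mathrm d\gamma(x_1,x_2)\Big)^{1/p}\in[0,\infty],$$ where $\Gamma(\mu_1,\mu_2)$ is the set of all probability measures on $X\times X$ with marginals $\mu_1$ and $\mu_2$. Let $r>0$ and let $\nu\in\mathcal P(X)$ have a finite $p$-th moment, i.e. $\int_X d(x,x_0)^p\,\mathrm d\nu(x)<\infty$ for some $x_0\in X$. Then the Wasserstein ball $$\mathcal B_r(\nu)=\{\mu\in\mathcal P(X) : W_p(\mu,\nu)\le r\}$$ is weakly compact: it is a compact, and also a sequentially compact, subset of $\mathcal P(X)$ equipped with the topology of weak convergence (convergence of $\int_X g\,\mathrm d\mu$ for every bounded continuous $g:X\to\mathbb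 R$). -/

import Mathlib

open MeasureTheory Set
open scoped ENNReal

noncomputable section

namespace WassersteinBall

variable {X : Type*} [MetricSpace X] [MeasurableSpace X]

/-- The couplings of `μ` and `ν`: probability measures on `X × X` with marginals `μ` and `ν`. -/
def couplings (μ ν : ProbabilityMeasure X) : Set (ProbabilityMeasure (X × X)) :=
  {γ | (γ : Measure (X × X)).map Prod.fst = (μ : Measure X) ∧
       (γ : Measure (X × X)).map Prod.snd = (ν : Measure X)}

/-- The `p`-th Wasserstein distance, as an extended nonnegative number (it may be infinite, since
no moment condition is imposed on the two measures). -/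
def wassersteinDist (p : ℝ) (μ ν : ProbabilityMeasure X) : ℝ≥0∞ :=
  ⨅ γ ∈ couplings μ ν, (∫⁻ z, edist z.1 z.2 ^ p ∂(γ : Measure (X × X))) ^ (1 / p)

/-- The closed Wasserstein ball of radius `r` centred at `ν`, among all Borel probability
measures. -/
def wassersteinBall (p r : ℝ) (ν : ProbabilityMeasure X) : Set (ProbabilityMeasure X) :=
  {μ | wassersteinDist p μ ν ≤ ENNReal.ofReal r}

/-- Finiteness of the `p`-th moment: `∫ d(x, x₀)^p dμ(x) < ∞` for some `x₀`. -/
def HasFiniteMoment (p : ℝ) (μ : ProbabilityMeasure X) : Prop :=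
  ∃ x₀ : X, ∫⁻ x, edist x x₀ ^ p ∂(μ : Measure X) < ∞

end WassersteinBall

end

/-!
A coupling of `μ` and `ν` is a probability measure on `X × X` whose first marginal is `μ` and whose
second marginal is `ν`. The first marginal is left free: for a finite bound `c`, consider all
probability measures `γ` on `X × X` with second marginal `ν` and transport cost `∫ d ^ p dγ ≤ c`.

* This set is closed: marginals depend continuously on `γ`, and the cost is lower semicontinuous,
  being the supremum of the integrals of the bounded continuous functions `min (d ^ p) n`
  (`isClosed_setOf_transportCost_le`).
* It is tight: `ν` is concentrated on a compact set `K` up to a small mass, and by Markov's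
  inequality `γ` gives small mass to `{d ^ p ≥ n}` for large `n`. As `X` is proper, the pairs `(x, y)`
  with `y ∈ K` and `d(x, y)` bounded lie in a compact set (`isTightMeasureSet_boundedTransportPlans`).

By Prokhorov's theorem it is compact, hence so is its image under the first marginal. The
Wasserstein ball of radius `r` is the intersection over all finite `c > r` of these images for the
bounds `c ^ p` (`wassersteinBall_eq_iInter`), so it is compact; no existence of optimal couplings is
needed. Sequential compactness follows because weak convergence of probability measures on a
separable metric space is metrizable.
-/

open Filter Topology
open scoped NNReal

namespace WassersteinBall

variable {X : Type*} [MetricSpace X] [MeasurableSpace X]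

/-- The probability measures on `X × X` with second marginal `ν` and transport cost
`∫ d(x, y) ^ p` at most `c`; the first marginal is arbitrary. -/
def boundedTransportPlans (p : ℝ) (c : ℝ≥0∞) (ν : ProbabilityMeasure X) :
    Set (ProbabilityMeasure (X × X)) :=
  {γ | (γ : Measure (X × X)).map Prod.snd = (ν : Measure X) ∧
    ∫⁻ z, edist z.1 z.2 ^ p ∂(γ : Measure (X × X)) ≤ c}

/-- The truncated cost `min (d(x, y) ^ p) n`. -/
noncomputable def truncatedCost {p : ℝ} (hp : 0 ≤ p) (n : ℕ) : BoundedContinuousFunction (X × X) ℝ≥0 :=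
  BoundedContinuousFunction.mkOfBound
    ⟨fun z ↦ min (nndist z.1 z.2 ^ p) n,
      ((NNReal.continuous_rpow_const hp).comp continuous_nndist).min continuous_const⟩ n
    (fun z w ↦ by
      refine (NNReal.dist_eq _ _).trans_le (abs_sub_le_of_nonneg_of_le (NNReal.coe_nonneg _) ?_
        (NNReal.coe_nonneg _) ?_)
      · exact_mod_cast min_le_right _ _
      · exact_mod_cast min_le_right _ _)

omit [MeasurableSpace X] in
lemma coe_truncatedCost {p : ℝ} (hp : 0 ≤ p) (n : ℕ) (z : X × X) :
    (truncatedCost hp n z : ℝ≥0∞) = min (edist z.1 z.2 ^ p) n := by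
  change ((min (nndist z.1 z.2 ^ p) (n : ℝ≥0) : ℝ≥0) : ℝ≥0∞) = _
  rw [ENNReal.coe_min, ENNReal.coe_rpow_of_nonneg _ hp, edist_nndist, ENNReal.coe_natCast]

lemma iSup_min_natCast (a : ℝ≥0∞) : ⨆ n : ℕ, min a n = a := by
  rw [← inf_iSup_eq, ENNReal.iSup_natCast, inf_top_eq]

variable [BorelSpace X] [SecondCountableTopology X]

lemma lintegral_cost_eq_iSup {p : ℝ} (hp : 0 ≤ p) (γ : Measure (X × X)) :
    ∫⁻ z, edist z.1 z.2 ^ p ∂γ = ⨆ n : ℕ, ∫⁻ z, truncatedCost hp n z ∂γ := by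
  rw [← lintegral_iSup (fun n ↦ (truncatedCost hp n).continuous.measurable.coe_nnreal_ennreal)]
  · simp_rw [coe_truncatedCost, iSup_min_natCast]
  · intro m n hmn z
    simp only [coe_truncatedCost]
    gcongr

lemma isClosed_setOf_transportCost_le {p : ℝ} (hp : 0 ≤ p) (c : ℝ≥0∞) :
    IsClosed {γ : ProbabilityMeasure (X × X) |
      ∫⁻ z, edist z.1 z.2 ^ p ∂(γ : Measure (X × X)) ≤ c} := by
  simp only [lintegral_cost_eq_iSup hp, iSup_le_iff, ofPred_forall]
  exact isClosed_iInter fun n ↦ isClosed_le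
    (ProbabilityMeasure.continuous_lintegral_boundedContinuousFunction (truncatedCost hp n))
    continuous_const

lemma continuous_fst_marginal : Continuous fun γ : ProbabilityMeasure (X × X) ↦
    γ.map (f := Prod.fst) measurable_fst.aemeasurable :=
  ProbabilityMeasure.continuous_map continuous_fst

lemma isClosed_boundedTransportPlans {p : ℝ} (hp : 0 ≤ p) (c : ℝ≥0∞) (ν : ProbabilityMeasure X) :
    IsClosed (boundedTransportPlans p c ν) := by
  have hmarginal : IsClosed {γ : ProbabilityMeasure (X × X) |
      γ.map (f := Prod.snd) measurable_snd.aemeasurable = ν} :=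
    isClosed_eq (ProbabilityMeasure.continuous_map continuous_snd) continuous_const
  convert hmarginal.inter (isClosed_setOf_transportCost_le hp c) using 1
  ext γ
  rw [mem_inter_iff, mem_ofPred_eq, ← ProbabilityMeasure.toMeasure_injective.eq_iff,
    ProbabilityMeasure.toMeasure_map]
  rfl

omit [MeasurableSpace X] [BorelSpace X] [SecondCountableTopology X] in
/-- In a proper space, the pairs with second entry in a compact set and bounded transport cost lie
in a compact set. -/
lemma exists_isCompact_of_cost_le [ProperSpace X] {p : ℝ} (hp : 0 < p) {K : Set X}
    (hK : IsCompact K) {b : ℝ≥0∞} (hb : b ≠ ∞) :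
    ∃ L : Set (X × X), IsCompact L ∧ ∀ z : X × X, z.2 ∈ K → edist z.1 z.2 ^ p ≤ b → z ∈ L := by
  have hR : b ^ p⁻¹ ≠ ∞ := ENNReal.rpow_ne_top_of_nonneg (inv_nonneg.2 hp.le) hb
  refine ⟨Metric.cthickening (b ^ p⁻¹).toReal K ×ˢ K, hK.cthickening.prod hK, fun z hz hzb ↦ ?_⟩
  refine ⟨Metric.mem_cthickening_of_edist_le _ _ _ _ hz ?_, hz⟩
  rwa [ENNReal.ofReal_toReal hR, ENNReal.le_rpow_inv_iff hp]

lemma isTightMeasureSet_boundedTransportPlans [ProperSpace X] {p : ℝ} (hp : 0 < p) {c : ℝ≥0∞}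
    (hc : c ≠ ∞) (ν : ProbabilityMeasure X) :
    IsTightMeasureSet {(γ : Measure (X × X)) | γ ∈ boundedTransportPlans p c ν} := by
  rw [isTightMeasureSet_iff_exists_isCompact_measure_compl_le]
  intro ε hε
  have hε2 : ε / 2 ≠ 0 := (ENNReal.half_pos hε.ne').ne'
  obtain ⟨K, hK, hνK⟩ := isTightMeasureSet_iff_exists_isCompact_measure_compl_le.1
    (isTightMeasureSet_singleton (μ := (ν : Measure X))) (ε / 2) (pos_iff_ne_zero.2 hε2)
  obtain ⟨n, hn, hcn⟩ := ENNReal.exists_nat_pos_mul_gt hε2 hc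
  have hn0 : (n : ℝ≥0∞) ≠ 0 := by exact_mod_cast hn.ne'
  obtain ⟨L, hL, hmem⟩ := exists_isCompact_of_cost_le hp hK (ENNReal.natCast_ne_top n)
  refine ⟨L, hL, ?_⟩
  rintro _ ⟨γ, ⟨hγν, hγc⟩, rfl⟩
  have hsub : Lᶜ ⊆ Prod.snd ⁻¹' Kᶜ ∪ {z : X × X | (n : ℝ≥0∞) ≤ edist z.1 z.2 ^ p} := by
    intro z hz
    by_contra h
    simp only [mem_union, mem_preimage, mem_compl_iff, mem_ofPred_eq, not_or, not_not,
      not_le] at h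
    exact hz (hmem z h.1 h.2.le)
  have hfar : (γ : Measure (X × X)) {z | (n : ℝ≥0∞) ≤ edist z.1 z.2 ^ p} ≤ ε / 2 := by
    refine (meas_ge_le_lintegral_div ?_ hn0 (ENNReal.natCast_ne_top n)).trans ?_
    · exact (measurable_edist.pow_const p).aemeasurable
    · refine ENNReal.div_le_of_le_mul' (hγc.trans hcn.le)
  have hout : (γ : Measure (X × X)) (Prod.snd ⁻¹' Kᶜ) ≤ ε / 2 := by
    rw [← Measure.map_apply measurable_snd hK.measurableSet.compl, hγν]
    exact hνK _ rfl
  calc (γ : Measure (X × X)) Lᶜ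
      ≤ _ := (measure_mono hsub).trans (measure_union_le _ _)
    _ ≤ ε / 2 + ε / 2 := add_le_add hout hfar
    _ = ε := ENNReal.add_halves ε

lemma isCompact_boundedTransportPlans [ProperSpace X] {p : ℝ} (hp : 0 < p) {c : ℝ≥0∞}
    (hc : c ≠ ∞) (ν : ProbabilityMeasure X) : IsCompact (boundedTransportPlans p c ν) := by
  rw [← (isClosed_boundedTransportPlans hp.le c ν).closure_eq]
  exact isCompact_closure_of_isTightMeasureSet (isTightMeasureSet_boundedTransportPlans hp hc ν)

omit [SecondCountableTopology X] [BorelSpace X] in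
/-- The infimum defining the Wasserstein distance need not be known to be attained: the ball is an
intersection over all strictly larger radii. -/
lemma wassersteinBall_eq_iInter {p : ℝ} (hp : 0 < p) (r : ℝ) (ν : ProbabilityMeasure X) :
    wassersteinBall p r ν = ⋂ c ∈ Ioo (ENNReal.ofReal r) ∞,
      (fun γ : ProbabilityMeasure (X × X) ↦ γ.map (f := Prod.fst) measurable_fst.aemeasurable) ''
        boundedTransportPlans p (c ^ p) ν := by
  ext μ
  simp only [mem_iInter, mem_image]
  constructor
  · intro hμ c hc
    obtain ⟨γ, hγ⟩ := iInf_lt_iff.1 (lt_of_le_of_lt hμ hc.1)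
    obtain ⟨⟨hγμ, hγν⟩, hlt⟩ := iInf_lt_iff.1 hγ
    refine ⟨γ, ⟨hγν, ?_⟩, ?_⟩
    · rw [one_div] at hlt
      exact (ENNReal.rpow_inv_le_iff hp).1 hlt.le
    · apply ProbabilityMeasure.toMeasure_injective
      rw [ProbabilityMeasure.toMeasure_map, hγμ]
  · intro h
    change wassersteinDist p μ ν ≤ ENNReal.ofReal r
    refine le_of_forall_gt_imp_ge_of_dense fun c hc ↦ ?_
    rcases eq_or_ne c ∞ with rfl | hc'
    · exact le_top
    obtain ⟨γ, ⟨hγν, hγc⟩, rfl⟩ := h c ⟨hc, hc'.lt_top⟩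
    have hγ : γ ∈ couplings (γ.map (f := Prod.fst) measurable_fst.aemeasurable) ν :=
      ⟨(ProbabilityMeasure.toMeasure_map γ measurable_fst.aemeasurable).symm, hγν⟩
    refine (iInf₂_le γ hγ).trans ?_
    rw [one_div]
    exact (ENNReal.rpow_inv_le_iff hp).2 hγc

lemma isCompact_wassersteinBall [ProperSpace X] {p : ℝ} (hp : 0 < p) (r : ℝ)
    (ν : ProbabilityMeasure X) : IsCompact (wassersteinBall p r ν) := by
  rw [wassersteinBall_eq_iInter hp]
  have hcpt (c : ℝ≥0∞) (hc : c ∈ Ioo (ENNReal.ofReal r) ∞) := (isCompact_boundedTransportPlans hp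
    (ENNReal.rpow_ne_top_of_nonneg hp.le hc.2.ne) ν).image continuous_fst_marginal
  obtain ⟨c, hc⟩ := exists_between (ENNReal.ofReal_lt_top (r := r))
  exact (hcpt c hc).of_isClosed_subset (isClosed_biInter fun c hc ↦ (hcpt c hc).isClosed)
    (biInter_subset_of_mem hc)

end WassersteinBall

/-- The topology on `ProbabilityMeasure X` is that of weak convergence, i.e. of convergence of the
integrals of all bounded continuous functions. -/
theorem theorem1 {X : Type*} [MetricSpace X] [CompleteSpace X] [TopologicalSpace.SeparableSpace X]
    [ProperSpace X] [MeasurableSpace X] [BorelSpace X]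
    (p : ℝ) (hp : 1 ≤ p) (r : ℝ) (hr : 0 < r)
    (ν : ProbabilityMeasure X) (hν : WassersteinBall.HasFiniteMoment p ν) :
    IsCompact (WassersteinBall.wassersteinBall p r ν) ∧
      IsSeqCompact (WassersteinBall.wassersteinBall p r ν) := by
  have hcpt := WassersteinBall.isCompact_wassersteinBall (zero_lt_one.trans_le hp) r ν
  exact ⟨hcpt, hcpt.isSeqCompact⟩
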